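/- Let $\Sigma=\{0,1\}$; a complexity class is any collection of subsets of $\Sigma^*$. For $A,B\subseteq\Sigma^*$ let $A\oplus B=\{x0 \mid x\in A\}\cup\{x1\mid x\in B\}$. DPTM abbreviates "deterministic polynomial-time oracle Turing machine", where the polynomial time bound is independent of the oracles. For complexity classes $\mathcal C$ and $\mathcal D$: - $\mathrm P^{\mathcal C:\mathcal D}$ is the class of languages $L$ for which there are $C\in\mathcal C$, $D\in\mathcal D$ and a DPTM that accepts $L$ and that, on every input, makes at most one query to $C$ followed by at most one query to $D$. - $\mathrm P_{1,1\text{-tt}}^{(\mathcal C,\mathcal D)}$ is the class of languages $L$ for which there are $C\in\mathcal C$, $D\in\mathcal D$ and a DPTM that accepts $L$ and that, on every input, makes simultaneously (in parallel) at most one query to $C$ and at most one query to $D$. - $A\le_m^{p,\mathcal D[1]}B$ means that there is a total function $f:\Sigma^*\to\Sigma^*$, computable by a DPTM that, on every input, makes at most one query to some fixed $D\in\mathcal D$, such that $x\in A\iff f(x)\in B$ for all $x\in\Sigma^*$. Theorem. Let $\mathcal C$ and $\mathcal D$ be complexity classes such that $\mathcal C$ is closed under disjoint union (if $A,B\in\mathcal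 C$ then $A\oplus B\in\mathcal C$) and $\mathcal C$ is closed downwards under $\le_m^{p,\mathcal D[1]}$ (if $B\in\mathcal C$ and $A\le_m^{p,\mathcal D[1]}B$ then $A\in\mathcal C$). Then $$\mathrm P^{\mathcal C:\mathcal D}=\mathrm P^{\mathcal D:\mathcal C}=\mathrm P_{1,1\text{-tt}}^{(\mathcal C,\mathcal D)}.$$ -/

import Mathlib

/-! # Polynomial-time machines with two oracles and restricted query access

Words are lists of bits, languages are Mathlib's `Language Bool = Set (List Bool)`, and a complexity
class is an arbitrary set of languages.  The machine model is Mathlib's multi-stack Turing machine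
`Turing.TM2` (the model behind `Turing.FinTM2` and `Turing.TM2ComputableInPolyTime`), extended with
oracle instructions. -/

namespace QueryOrder

/-- A complexity class: any collection of subsets of `{0,1}*`. -/
abbrev ComplexityClass : Type := Set (Language Bool)

/-- The disjoint union `A ⊕ B = {x0 | x ∈ A} ∪ {x1 | x ∈ B}`. -/
def disjointUnion (A B : Language Bool) : Language Bool :=
  {w | (∃ x ∈ A, w = x ++ [false]) ∨ (∃ x ∈ B, w = x ++ [true])}

/-- `𝒞` contains `A ⊕ B` whenever it contains `A` and `B`. -/
def ClosedUnderDisjointUnion (𝒞 : ComplexityClass) : Prop :=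
  ∀ A ∈ 𝒞, ∀ B ∈ 𝒞, disjointUnion A B ∈ 𝒞

/-- The distinguished stacks of an oracle machine: the input, the output, and one query stack for
each of the two oracles. -/
inductive Port where
  | input
  | output
  | query₁
  | query₂
  deriving DecidableEq

/-- The possible oracle steps: a query to the first oracle alone, a query to the second oracle
alone, or two simultaneous queries, one to each oracle. -/
inductive Access where
  | fst
  | snd
  | both

/-- What is attached to a label of an oracle machine: an ordinary `Turing.TM2` statement, or an
oracle step.  An oracle step asks whether the word on the query stack of the oracle belongs to it
(for `askBoth`: both questions at once) and branches on the answer(s). -/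
inductive Instr (K : Type) (S : Type) (Λ : Type) (σ : Type) where
  | run (s : Turing.TM2.Stmt (fun _ : K => S) Λ σ)
  | askFst (next : Bool → Λ)
  | askSnd (next : Bool → Λ)
  | askBoth (next : Bool → Bool → Λ)

/-- A deterministic Turing machine with two oracles.  It has the four distinguished stacks and
finitely many further work stacks; the stack symbols are the bits together with a finite set `Γ` of
further symbols. -/
structure OracleTM where
  /-- work stacks -/
  W : Type
  [decEqW : DecidableEq W]
  [finiteW : Finite W]
  /-- stack symbols other than the two bits -/
  Γ : Type
  [finiteΓ : Finite Γ]
  /-- program labels -/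
  Λ : Type
  [finiteΛ : Finite Λ]
  /-- internal states -/
  σ : Type
  [finiteσ : Finite σ]
  /-- the label at which the computation starts -/
  main : Λ
  /-- the internal state in which the computation starts -/
  initialState : σ
  /-- the internal states in which a halted machine accepts -/
  accepting : σ → Bool
  /-- the program -/
  program : Λ → Instr (Port ⊕ W) (Bool ⊕ Γ) Λ σ

attribute [instance] OracleTM.decEqW OracleTM.finiteW OracleTM.finiteΓ OracleTM.finiteΛ
  OracleTM.finiteσ

/-- The word on a stack: the bits read from the top down to the first symbol that is not a bit,
or to the bottom of the stack. -/
def bitPrefix {Γ : Type} : List (Bool ⊕ Γ) → List Bool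
  | Sum.inl b :: s => b :: bitPrefix s
  | _ => []

namespace OracleTM

/-- A configuration: a configuration of the underlying stack machine (its label is `none` when the
machine has halted), and a log, in chronological order, of the oracle steps made so far.  The
machine has no access to the log. -/
structure Cfg (M : OracleTM) where
  core : Turing.TM2.Cfg (fun _ : Port ⊕ M.W => Bool ⊕ M.Γ) M.Λ M.σ
  log : List Access

variable (M : OracleTM)

/-- The initial configuration: the input word is on the input stack with its first letter on top,
and all other stacks are empty. -/
def init (x : List Bool) : M.Cfg where
  core :=
    { l := some M.main
      var := M.initialState
      stk := fun k => if k = Sum.inl Port.input then x.map Sum.inl else [] }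
  log := []

open Classical in
/-- One step with oracles `A` and `B`; a halted configuration stays as it is. -/
noncomputable def step (A B : Language Bool) (c : M.Cfg) : M.Cfg :=
  match c.core.l with
  | none => c
  | some l =>
    match M.program l with
    | .run s => ⟨Turing.TM2.stepAux s c.core.var c.core.stk, c.log⟩
    | .askFst next =>
        ⟨⟨some (next (decide (bitPrefix (c.core.stk (.inl .query₁)) ∈ A))),
          c.core.var, c.core.stk⟩, c.log ++ [.fst]⟩
    | .askSnd next =>
        ⟨⟨some (next (decide (bitPrefix (c.core.stk (.inl .query₂)) ∈ B))),
          c.core.var, c.core.stk⟩, c.log ++ [.snd]⟩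
    | .askBoth next =>
        ⟨⟨some (next (decide (bitPrefix (c.core.stk (.inl .query₁)) ∈ A))
            (decide (bitPrefix (c.core.stk (.inl .query₂)) ∈ B))),
          c.core.var, c.core.stk⟩, c.log ++ [.both]⟩

/-- The configuration after `n` steps on input `x` with oracles `A` and `B`. -/
noncomputable def runFor (A B : Language Bool) (n : ℕ) (x : List Bool) : M.Cfg :=
  (M.step A B)^[n] (M.init x)

end OracleTM

/-- A deterministic polynomial-time oracle Turing machine: it comes with a polynomial clock, which
does not depend on the oracles, and has halted when the clock runs out. -/
structure DPTM extends OracleTM where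
  /-- the clock, a polynomial in the length of the input -/
  clock : Polynomial ℕ
  halts : ∀ (A B : Language Bool) (x : List Bool),
    (toOracleTM.runFor A B (clock.eval x.length) x).core.l = none

namespace DPTM

variable (M : DPTM)

/-- The halting configuration of `M` on input `x` with oracles `A` and `B`. -/
noncomputable def final (A B : Language Bool) (x : List Bool) : M.toOracleTM.Cfg :=
  M.toOracleTM.runFor A B (M.clock.eval x.length) x

/-- The oracle steps made by `M` on input `x` with oracles `A` and `B`, in chronological order. -/
noncomputable def accesses (A B : Language Bool) (x : List Bool) : List Access :=
  (M.final A B x).log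

/-- `M` accepts `x` with oracles `A` and `B`. -/
def Accepts (A B : Language Bool) (x : List Bool) : Prop :=
  M.accepting (M.final A B x).core.var = true

/-- The word that `M` outputs on input `x` with oracles `A` and `B`. -/
noncomputable def output (A B : Language Bool) (x : List Bool) : List Bool :=
  bitPrefix ((M.final A B x).core.stk (.inl .output))

/-- The language accepted by `M` with oracles `A` and `B`. -/
def acceptedLanguage (A B : Language Bool) : Language Bool :=
  {x | M.Accepts A B x}

/-- On every input, `M` makes at most one query to `A` followed by at most one query to `B`. -/
def IsOrdered (A B : Language Bool) : Prop :=
  ∀ x, (M.accesses A B x).Sublist [Access.fst, Access.snd]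

/-- On every input, `M` makes simultaneously at most one query to `A` and at most one query to `B`:
there is at most one oracle step. -/
def IsParallel (A B : Language Bool) : Prop :=
  ∀ x, (M.accesses A B x).length ≤ 1

end DPTM

/-- The class `P^{𝒞:𝒟}`. -/
def POrdered (𝒞 𝒟 : ComplexityClass) : ComplexityClass :=
  {L | ∃ C ∈ 𝒞, ∃ D ∈ 𝒟, ∃ M : DPTM, M.IsOrdered C D ∧ L = M.acceptedLanguage C D}

/-- The class `P_{1,1-tt}^{(𝒞,𝒟)}`. -/
def PParallel (𝒞 𝒟 : ComplexityClass) : ComplexityClass :=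
  {L | ∃ C ∈ 𝒞, ∃ D ∈ 𝒟, ∃ M : DPTM, M.IsParallel C D ∧ L = M.acceptedLanguage C D}

/-- The class `FP^{𝒟[1]}` of total functions computed in polynomial time with at most one query to
some `D ∈ 𝒟` (the first oracle; the second oracle is the empty language `0` and is never queried). -/
def FPOneQuery (𝒟 : ComplexityClass) : Set (List Bool → List Bool) :=
  {f | ∃ D ∈ 𝒟, ∃ M : DPTM, (∀ x, (M.accesses D 0 x).Sublist [Access.fst]) ∧
    ∀ x, f x = M.output D 0 x}

/-- The reducibility `A ≤_m^{p,𝒟[1]} B`. -/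
def ManyOneReducibleOneQuery (𝒟 : ComplexityClass) (A B : Language Bool) : Prop :=
  ∃ f ∈ FPOneQuery 𝒟, ∀ x, x ∈ A ↔ f x ∈ B

/-- `𝒞` is closed downwards under `≤_m^{p,𝒟[1]}`. -/
def ClosedDownwardOneQuery (𝒞 𝒟 : ComplexityClass) : Prop :=
  ∀ A B : Language Bool, B ∈ 𝒞 → ManyOneReducibleOneQuery 𝒟 A B → A ∈ 𝒞

end QueryOrder

/-! Two simultaneous queries can be asked one after the other, in either order, so the parallel
class lies in both ordered classes (`PParallel_subset_POrdered`, `PParallel_subset_POrdered_swap`).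
For the converse inclusions, the query to `C ∈ 𝒞` is replaced by a query about the input `x` itself
to another member `A` of `𝒞`. Such a query need not wait for any answer.

If the `𝒟`-query comes first (`POrdered_swap_subset_PParallel`), let `A` be the set of `x` whose
`𝒞`-query lies in `C`. One query to `𝒟` suffices to find that word, so `A ∈ 𝒞`.

If the `𝒞`-query comes first (`POrdered_subset_PParallel`), let `v₀(x)` and `v₁(x)` be the verdicts
when it is answered no and yes; each costs one `𝒟`-query. Let `A` be the set of `x` with `v₀(x) ≠
v₁(x)` whose `𝒞`-query lies in `C`. The verdict is `v₀(x)` xor `[x ∈ A]`. Comparing `v₀` with `v₁`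
would take two `𝒟`-queries, so `A` is reduced to `C` in two stages: `x ↦ v₀(x)x`, and `bx ↦` the
`𝒞`-query if `v₁(x) ≠ b`, a fixed word outside `C` otherwise. If there is no such word, the verdict
is `v₁(x)`.

All machines come from one construction, `Driver.machine`: it runs `M` from one oracle step to the
next while a finite control chooses the answers. Wrong answers do not endanger termination, because
the clock of `M` holds for all oracles, in particular constant ones (`DPTM.stage_spec`).
`Driver.exists_dptm` supplies the clock of the simulation. -/

namespace QueryOrder

/-! ### Silent computation and oracle steps -/

/-- The reason why a machine interrupts its silent computation. -/
inductive Event where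
  | fst
  | snd
  | both
  | halt

/-- The log entry caused by an event. -/
def Event.log : Event → List Access
  | .fst => [.fst]
  | .snd => [.snd]
  | .both => [.both]
  | .halt => []

open Classical in
/-- The answer of the oracle `A` to the query `w`. -/
noncomputable def answer (A : Language Bool) (w : List Bool) : Bool := decide (w ∈ A)

theorem answer_eq_true {A : Language Bool} {w : List Bool} : answer A w = true ↔ w ∈ A := by
  simp [answer]

/-- The oracle that gives the same answer to every query. -/
def constantOracle (b : Bool) : Language Bool := {_w | b = true}

@[simp] theorem answer_constantOracle (b : Bool) (w : List Bool) :
    answer (constantOracle b) w = b := by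
  rw [Bool.eq_iff_iff, answer_eq_true]; rfl

namespace OracleTM

variable (M : OracleTM)

/-- Configurations of the underlying stack machine. -/
abbrev Core : Type := Turing.TM2.Cfg (fun _ : Port ⊕ M.W => Bool ⊕ M.Γ) M.Λ M.σ

/-- The ordinary statement attached to a label, if there is one. -/
def silentStmt : Option M.Λ → Option (Turing.TM2.Stmt (fun _ : Port ⊕ M.W => Bool ⊕ M.Γ) M.Λ M.σ)
  | none => none
  | some l => match M.program l with
    | .run s => some s
    | _ => none

/-- The event at a label without ordinary statement. -/
def event : Option M.Λ → Event
  | none => .halt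
  | some l => match M.program l with
    | .run _ => .halt
    | .askFst _ => .fst
    | .askSnd _ => .snd
    | .askBoth _ => .both

/-- The label that follows an oracle step whose questions are answered by `a` and `b`. -/
def resume (a b : Bool) : Option M.Λ → Option M.Λ
  | none => none
  | some l => match M.program l with
    | .run _ => some l
    | .askFst next => some (next a)
    | .askSnd next => some (next b)
    | .askBoth next => some (next a b)

/-- A configuration is settled if it has halted or is about to make an oracle step. -/
def Settled (c : M.Core) : Prop := M.silentStmt c.l = none

/-- One step without oracles; settled configurations stay as they are. -/
def silentStep (c : M.Core) : M.Core :=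
  match M.silentStmt c.l with
  | some s => Turing.TM2.stepAux s c.var c.stk
  | none => c

/-- Continue from a settled configuration with answers `a` and `b`. -/
def reply (a b : Bool) (c : M.Core) : M.Core := ⟨M.resume a b c.l, c.var, c.stk⟩

/-- The word on a stack of a configuration that is attached to a port. -/
def word (c : M.Core) (p : Port) : List Bool := bitPrefix (c.stk (.inl p))

variable {M}

theorem silentStep_of_settled {c : M.Core} (h : M.Settled c) : M.silentStep c = c := by
  unfold silentStep; rw [show M.silentStmt c.l = none from h]

theorem silentStep_of_silentStmt {c : M.Core} {s} (h : M.silentStmt c.l = some s) :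
    M.silentStep c = Turing.TM2.stepAux s c.var c.stk := by
  unfold silentStep; rw [h]

theorem step_of_not_settled (A B : Language Bool) {c : M.Core} (h : ¬ M.Settled c)
    (log : List Access) : M.step A B ⟨c, log⟩ = ⟨M.silentStep c, log⟩ := by
  obtain ⟨l, v, S⟩ := c
  cases l with
  | none => exact absurd rfl h
  | some l =>
    simp only [step, silentStep, silentStmt, Settled] at h ⊢
    cases hp : M.program l <;> simp_all

/-- Halting counts as an event with empty log and trivial reply, so one formula covers all four
events. -/
theorem step_of_settled (A B : Language Bool) {c : M.Core} (h : M.Settled c)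
    (log : List Access) : M.step A B ⟨c, log⟩ =
      ⟨M.reply (answer A (M.word c .query₁)) (answer B (M.word c .query₂)) c,
        log ++ (M.event c.l).log⟩ := by
  obtain ⟨l, v, S⟩ := c
  cases l with
  | none => simp [step, reply, resume, event, Event.log]
  | some l =>
    simp only [step, reply, resume, event, silentStmt, Settled] at h ⊢
    cases hp : M.program l <;> simp_all [Event.log, answer, word] <;> congr!

theorem eq_none_of_event_eq_halt {c : M.Core} (h : M.Settled c) (he : M.event c.l = .halt) :
    c.l = none := by
  obtain ⟨l, v, S⟩ := c
  cases l with
  | none => rfl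
  | some l =>
    simp only [event, silentStmt, Settled] at h he ⊢
    cases hp : M.program l <;> simp_all

theorem reply_of_event_eq_halt {c : M.Core} (he : M.event c.l = .halt) (a b : Bool) :
    M.reply a b c = c := by
  obtain ⟨l, v, S⟩ := c
  cases l with
  | none => rfl
  | some l =>
    simp only [event, reply, resume] at he ⊢
    cases hp : M.program l <;> simp_all

/-- The answer that is not asked for can be chosen freely. This is what lets a sequence of replies
be matched with a run under constant oracles. -/
theorem reply_of_event_eq_fst {c : M.Core} (he : M.event c.l = .fst) (a b b' : Bool) :
    M.reply a b c = M.reply a b' c := by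
  obtain ⟨l, v, S⟩ := c
  cases l with
  | none => rfl
  | some l =>
    simp only [event, reply, resume] at he ⊢
    cases hp : M.program l <;> simp_all

theorem reply_of_event_eq_snd {c : M.Core} (he : M.event c.l = .snd) (a a' b : Bool) :
    M.reply a b c = M.reply a' b c := by
  obtain ⟨l, v, S⟩ := c
  cases l with
  | none => rfl
  | some l =>
    simp only [event, reply, resume] at he ⊢
    cases hp : M.program l <;> simp_all

theorem settled_of_l_eq_none {c : M.Core} (h : c.l = none) : M.Settled c := by
  simp [Settled, h, silentStmt]

/-! ### Halting within a time bound -/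

variable (M)

/-- `M` reaches the halting configuration `f` from `c` within `n` steps. -/
def HaltsIn (A B : Language Bool) (n : ℕ) (c f : M.Cfg) : Prop :=
  ∃ m ≤ n, (M.step A B)^[m] c = f ∧ f.core.l = none

variable {M}
variable {A B : Language Bool} {n : ℕ} {c f : M.Cfg}

theorem step_of_l_eq_none (h : c.core.l = none) : M.step A B c = c := by
  unfold step; rw [h]

theorem HaltsIn.mono {m : ℕ} (h : M.HaltsIn A B n c f) (hnm : n ≤ m) : M.HaltsIn A B m c f := by
  obtain ⟨k, hk, h⟩ := h; exact ⟨k, hk.trans hnm, h⟩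

theorem HaltsIn.of_step (h : M.HaltsIn A B n (M.step A B c) f) : M.HaltsIn A B (n + 1) c f := by
  obtain ⟨k, hk, h, hf⟩ := h
  exact ⟨k + 1, by omega, by rwa [Function.iterate_succ_apply], hf⟩

/-- The bound is deliberately not lowered: one clock value then serves for every configuration along
a run. -/
theorem HaltsIn.step (h : M.HaltsIn A B n c f) : M.HaltsIn A B n (M.step A B c) f := by
  obtain ⟨k, hk, h, hf⟩ := h
  refine ⟨k, hk, ?_, hf⟩
  rw [← Function.iterate_succ_apply, Function.iterate_succ_apply', h, step_of_l_eq_none hf]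

theorem HaltsIn.iterate_eq (h : M.HaltsIn A B n c f) : (M.step A B)^[n] c = f := by
  obtain ⟨k, hk, h, hf⟩ := h
  obtain ⟨j, rfl⟩ := Nat.exists_eq_add_of_le hk
  rw [add_comm, Function.iterate_add_apply, h]
  exact Function.iterate_fixed (step_of_l_eq_none hf) _

theorem HaltsIn.eq_of_l_eq_none (h : M.HaltsIn A B n c f) (hc : c.core.l = none) : c = f := by
  rw [← h.iterate_eq, Function.iterate_fixed (step_of_l_eq_none hc)]

/-- As long as the configuration is not settled, a silent step is a genuine step and uses up one
unit of the bound; a halted configuration is settled. -/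
theorem HaltsIn.settled {c : M.Core} {log : List Access} (h : M.HaltsIn A B n ⟨c, log⟩ f) :
    M.Settled (M.silentStep^[n] c) := by
  induction n generalizing c with
  | zero =>
    obtain ⟨k, hk, h, hf⟩ := h
    obtain rfl : k = 0 := by omega
    subst h
    exact settled_of_l_eq_none hf
  | succ n ih =>
    by_cases hc : M.Settled c
    · rwa [Function.iterate_fixed (silentStep_of_settled hc)]
    · obtain ⟨k, hk, h, hf⟩ := h
      cases k with
      | zero => subst h; exact absurd (settled_of_l_eq_none hf) hc
      | succ k =>
        rw [Function.iterate_succ_apply, step_of_not_settled _ _ hc] at h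
        exact ih ⟨k, by omega, h, hf⟩

theorem HaltsIn.silentStep {c : M.Core} {log : List Access} (h : M.HaltsIn A B n ⟨c, log⟩ f)
    (m : ℕ) : M.HaltsIn A B n ⟨M.silentStep^[m] c, log⟩ f := by
  induction m generalizing c with
  | zero => exact h
  | succ m ih =>
    rw [Function.iterate_succ_apply]
    by_cases hc : M.Settled c
    · rw [silentStep_of_settled hc]; exact ih h
    · apply ih; rw [← step_of_not_settled A B hc]; exact h.step

/-- The log only grows, so a restriction on the final log restricts the events met on the way. -/
theorem log_prefix_iterate (n : ℕ) (c : M.Cfg) : c.log <+: ((M.step A B)^[n] c).log := by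
  induction n generalizing c with
  | zero => exact List.prefix_rfl
  | succ n ih =>
    refine List.IsPrefix.trans ?_ (ih _)
    obtain ⟨c, log⟩ := c
    by_cases hc : M.Settled c
    · rw [step_of_settled _ _ hc]; exact List.prefix_append _ _
    · rw [step_of_not_settled _ _ hc]

theorem HaltsIn.log_prefix (h : M.HaltsIn A B n c f) : c.log <+: f.log := by
  obtain ⟨k, -, rfl, -⟩ := h; exact log_prefix_iterate k c

end OracleTM

/-! ### Settled configurations of a clocked machine -/

namespace DPTM

variable (M : DPTM)

/-- The first settled configuration of `M` on input `x` that is reached from `c`. -/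
def settle (x : List Bool) (c : M.Core) : M.Core := M.silentStep^[M.clock.eval x.length] c

/-- The settled configuration reached on input `x` after `n` oracle steps, each of them answered
by `a` and `b`. -/
def stage (x : List Bool) (a b : Bool) : ℕ → M.Core
  | 0 => M.settle x (M.init x).core
  | n + 1 => M.settle x (M.reply a b (stage x a b n))

variable {M}

/-- The settled configuration that `M` reaches first on input `x`. -/
abbrev first (M : DPTM) (x : List Bool) : M.Core := M.settle x (M.init x).core

/-- The settled configuration that follows a settled one. -/
noncomputable def next (M : DPTM) (A B : Language Bool) (x : List Bool) (c : M.Core) : M.Core :=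
  M.settle x (M.reply (answer A (M.word c .query₁)) (answer B (M.word c .query₂)) c)

theorem haltsIn_init (A B : Language Bool) (x : List Bool) :
    M.HaltsIn A B (M.clock.eval x.length) (M.init x) (M.final A B x) :=
  ⟨_, le_rfl, rfl, M.halts A B x⟩

theorem haltsIn_settle_init (A B : Language Bool) (x : List Bool) :
    M.HaltsIn A B (M.clock.eval x.length) ⟨M.first x, []⟩ (M.final A B x) :=
  (haltsIn_init A B x).silentStep (log := []) _

theorem haltsIn_next {A B : Language Bool} {x : List Bool} {c : M.Core}
    {log : List Access} {f : M.Cfg} (hc : M.Settled c)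
    (h : M.HaltsIn A B (M.clock.eval x.length) ⟨c, log⟩ f) :
    M.HaltsIn A B (M.clock.eval x.length) ⟨M.next A B x c, log ++ (M.event c.l).log⟩ f := by
  have := h.step
  rw [OracleTM.step_of_settled _ _ hc] at this
  exact this.silentStep _

theorem settled_next_of_haltsIn {A B : Language Bool} {x : List Bool} {c : M.Core}
    {log : List Access} {f : M.Cfg} (hc : M.Settled c)
    (h : M.HaltsIn A B (M.clock.eval x.length) ⟨c, log⟩ f) : M.Settled (M.next A B x c) := by
  have := h.step
  rw [OracleTM.step_of_settled _ _ hc] at this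
  exact this.settled

/-- Fixed answers `a` and `b` are those of two constant oracles, for which the clock is valid too.
Hence `settle` reaches a settled configuration even if the answers are wrong for the actual oracles.
-/
theorem stage_spec (x : List Bool) (a b : Bool) (n : ℕ) : M.Settled (M.stage x a b n) ∧
    ∃ log, M.HaltsIn (constantOracle a) (constantOracle b) (M.clock.eval x.length)
      ⟨M.stage x a b n, log⟩ (M.final (constantOracle a) (constantOracle b) x) := by
  induction n with
  | zero => exact ⟨(haltsIn_init (constantOracle a) (constantOracle b) x).settled (log := []), _,
      haltsIn_settle_init _ _ x⟩
  | succ n ih =>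
    obtain ⟨hs, log, h⟩ := ih
    have h1 := h.step
    rw [OracleTM.step_of_settled _ _ hs] at h1
    simp only [answer_constantOracle] at h1
    exact ⟨h1.settled, _, h1.silentStep _⟩

theorem stage_settled (x : List Bool) (a b : Bool) (n : ℕ) : M.Settled (M.stage x a b n) :=
  (stage_spec x a b n).1

end DPTM

/-! ### Simulating machines with a finite control -/

/-- What a port of a simulating machine contains: nothing, a copy of the input word of the
simulated machine, or a copy of the stack at a port of the simulated machine. -/
inductive Source where
  | nothing
  | word
  | stack (p : Port)
  deriving DecidableEq

/-- What a simulating machine does at an event of the simulated machine.  Its own oracle steps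
change only its control state; `reply a b q freeze` continues the simulated machine with the answers
`a` and `b`, and from then on leaves the output alone if `freeze` is set; `conclude acc out` ends
the simulation, where `acc` and `out` map the verdict of the simulated machine to the final verdict and
to the symbols that are put on top of the output (`none` is an end marker). -/
inductive Act (Q : Type) where
  | askFst (next : Bool → Q)
  | askSnd (next : Bool → Q)
  | askBoth (next : Bool → Bool → Q)
  | reply (a b : Bool) (q : Q) (freeze : Bool)
  | conclude (acc : Bool → Bool) (out : Bool → List (Option Bool))

/-- The finite control of a simulating machine.  If `skip` is set, then the first letter of the
input is handed to the control, and the simulated machine is run on the remaining letters. -/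
structure Driver where
  Q : Type
  [finiteQ : Finite Q]
  skip : Bool
  start : Option Bool → Q
  route : Port → Source
  act : Q → Event → Act Q

attribute [instance] Driver.finiteQ

instance : Finite Port :=
  Finite.of_injective (fun p : Port => (decide (p = .input), decide (p = .output),
    decide (p = .query₁))) fun p p' h => by cases p <;> cases p' <;> simp_all

namespace Driver

/-- The labels of a simulating machine: reading the input, reversing it, copying it, and the
simulation proper. -/
inductive Label (Λ Q : Type) where
  | start
  | reverse (b : Option Bool)
  | copy (b : Option Bool)
  | sim (l : Option Λ) (q : Q) (z : Bool)

instance {Λ Q : Type} [Finite Λ] [Finite Q] : Finite (Label Λ Q) := by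
  let f : Label Λ Q → Unit ⊕ Option Bool ⊕ Option Bool ⊕ (Option Λ × Q × Bool)
    | .start => .inl ()
    | .reverse b => .inr (.inl b)
    | .copy b => .inr (.inr (.inl b))
    | .sim l q z => .inr (.inr (.inr (l, q, z)))
  refine Finite.of_injective f ?_
  rintro (_ | b | b | ⟨l, q, z⟩) (_ | b' | b' | ⟨l', q', z'⟩) h <;> simp_all [f]

/-- Symbols of the simulated machine as symbols of the simulating machine. -/
def embed {Γ : Type} : Bool ⊕ Γ → Bool ⊕ Option Γ := Sum.map id some

/-- A left inverse of `embed`. -/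
def project {Γ : Type} : Bool ⊕ Option Γ → Bool ⊕ Γ
  | .inl b => .inl b
  | .inr (some g) => .inr g
  | .inr none => .inl false

@[simp] theorem project_embed {Γ : Type} (s : Bool ⊕ Γ) : project (embed s) = s := by
  cases s <;> rfl

theorem bitPrefix_map_embed {Γ : Type} (s : List (Bool ⊕ Γ)) :
    bitPrefix (s.map embed) = bitPrefix s := by
  induction s with
  | nil => rfl
  | cons a s ih => cases a with
    | inl b => exact congrArg (b :: ·) ih
    | inr g => rfl

theorem bitPrefix_map_inl {Γ : Type} (w : List Bool) (s : List (Bool ⊕ Γ)) :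
    bitPrefix (w.map Sum.inl ++ s) = w ++ bitPrefix s := by
  induction w with
  | nil => rfl
  | cons a w ih => simp [bitPrefix, ih]

/-- The bit or the end marker as a symbol of the simulating machine. -/
def outSymbol {Γ : Type} : Option Bool → Bool ⊕ Option Γ
  | some b => .inl b
  | none => .inr none

/-- The bit that has been read, if any. -/
def readBit {Γ : Type} : Option (Bool ⊕ Γ) → Option Bool
  | some (.inl b) => some b
  | _ => none

section Machine

variable (d : Driver) (M : OracleTM)

/-- The stacks of the simulating machine: its ports, a scratch stack, and private copies of all
stacks of the simulated machine. -/
abbrev StackIndex : Type := Port ⊕ Option (Port ⊕ M.W)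

/-- Statements of the simulating machine. -/
abbrev SimStmt : Type :=
  Turing.TM2.Stmt (fun _ : StackIndex M => Bool ⊕ Option M.Γ) (Label M.Λ d.Q) (M.σ × Option Bool)

variable {M}

/-- Whether the port `p` follows the changes of the stack `k`. -/
def follows (z : Bool) (k : Port ⊕ M.W) (p : Port) : Bool :=
  match k, d.route p with
  | .inl r, .stack r' => decide (r = r') && !(decide (p = .output) && z)
  | _, _ => false

/-- Apply an operation to the output and query stacks that satisfy a condition. -/
def onPorts (cond : Port → Bool) (op : Port → SimStmt d M → SimStmt d M) (s : SimStmt d M) :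
    SimStmt d M :=
  bif cond .output then op .output (q₁ s) else q₁ s
where
  q₂ (s : SimStmt d M) : SimStmt d M := bif cond .query₂ then op .query₂ s else s
  q₁ (s : SimStmt d M) : SimStmt d M := bif cond .query₁ then op .query₁ (q₂ s) else q₂ s

/-- Translation of the statements of the simulated machine. -/
def translate (q : d.Q) (z : Bool) :
    Turing.TM2.Stmt (fun _ : Port ⊕ M.W => Bool ⊕ M.Γ) M.Λ M.σ → SimStmt d M
  | .push k f s => d.onPorts (d.follows z k) (fun p => .push (.inl p) fun v => embed (f v.1))
      (.push (.inr (some k)) (fun v => embed (f v.1)) (translate q z s))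
  | .peek k f s => .peek (.inr (some k)) (fun v o => (f v.1 (o.map project), v.2))
      (translate q z s)
  | .pop k f s => d.onPorts (d.follows z k) (fun p => .pop (.inl p) fun v _ => v)
      (.pop (.inr (some k)) (fun v o => (f v.1 (o.map project), v.2)) (translate q z s))
  | .load f s => .load (fun v => (f v.1, v.2)) (translate q z s)
  | .branch f s t => .branch (fun v => f v.1) (translate q z s) (translate q z t)
  | .goto f => .goto fun v => .sim (some (f v.1)) q z
  | .halt => .goto fun _ => .sim none q z

/-- Put symbols on top of the output, set the verdict, and halt. -/
def finish (acc : Bool) (out : List (Option Bool)) : SimStmt d M :=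
  out.foldl (fun s b => .push (.inl .output) (fun _ => outSymbol b) s)
    (.load (fun v => (v.1, some acc)) .halt)

/-- The instruction that performs an action. -/
def perform (l : Option M.Λ) (z : Bool) :
    Act d.Q → Instr (StackIndex M) (Bool ⊕ Option M.Γ) (Label M.Λ d.Q) (M.σ × Option Bool)
  | .askFst next => .askFst fun a => .sim l (next a) z
  | .askSnd next => .askSnd fun b => .sim l (next b) z
  | .askBoth next => .askBoth fun a b => .sim l (next a b) z
  | .reply a b q freeze => .run (.goto fun _ => .sim (M.resume a b l) q (z || freeze))
  | .conclude acc out => .run (.branch (fun v => M.accepting v.1) (d.finish (acc true) (out true))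
      (d.finish (acc false) (out false)))

variable (M)

/-- Hand the first letter of the input to the control, if this is required. -/
def startStmt : SimStmt d M :=
  bif d.skip then
    .pop (.inl .input) (fun v o => (v.1, readBit o)) (.goto fun v => .reverse v.2)
  else .goto fun _ => .reverse none

/-- Move a letter of the input to the scratch stack. -/
def reverseStmt (b : Option Bool) : SimStmt d M :=
  .pop (.inl .input) (fun v o => (v.1, readBit o))
    (.branch (fun v => v.2.isSome)
      (.push (.inr none) (fun v => .inl (v.2.getD false)) (.goto fun _ => .reverse b))
      (.goto fun _ => .copy b))

/-- Move a letter from the scratch stack to the places where the input is needed. -/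
def copyStmt (b : Option Bool) : SimStmt d M :=
  .pop (.inr none) (fun v o => (v.1, readBit o))
    (.branch (fun v => v.2.isSome)
      (d.onPorts (fun p => decide (d.route p = .word) || decide (d.route p = .stack .input))
        (fun p => .push (.inl p) fun v => .inl (v.2.getD false))
        (.push (.inr (some (.inl .input))) (fun v => .inl (v.2.getD false))
          (.goto fun _ => .copy b)))
      (.goto fun _ => .sim (some M.main) (d.start b) false))

/-- The program of the simulating machine. -/
def simProgram : Label M.Λ d.Q →
    Instr (StackIndex M) (Bool ⊕ Option M.Γ) (Label M.Λ d.Q) (M.σ × Option Bool)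
  | .start => .run (d.startStmt M)
  | .reverse b => .run (d.reverseStmt M b)
  | .copy b => .run (d.copyStmt M b)
  | .sim l q z => match M.silentStmt l with
    | some s => .run (d.translate q z s)
    | none => d.perform l z (d.act q (M.event l))

/-- The machine that simulates `M` under the control of `d`. -/
def machine : OracleTM where
  W := Option (Port ⊕ M.W)
  Γ := Option M.Γ
  Λ := Label M.Λ d.Q
  σ := M.σ × Option Bool
  main := .start
  initialState := (M.initialState, none)
  accepting v := v.2.getD false
  program := d.simProgram M

end Machine

/-! ### Simulation of a single statement -/

section Simulation

variable (d : Driver) {M : OracleTM}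

/-- The content of a port of the simulating machine. -/
def port (z : Bool) (hold : List (Bool ⊕ Option M.Γ)) (x : List Bool)
    (S : Port ⊕ M.W → List (Bool ⊕ M.Γ)) (p : Port) : List (Bool ⊕ Option M.Γ) :=
  bif decide (p = .output) && z then hold else
  match d.route p with
  | .nothing => []
  | .word => x.map .inl
  | .stack r => (S (.inl r)).map embed

/-- The stacks of the simulating machine. -/
def simStacks (z : Bool) (hold : List (Bool ⊕ Option M.Γ)) (x : List Bool)
    (S : Port ⊕ M.W → List (Bool ⊕ M.Γ)) : StackIndex M → List (Bool ⊕ Option M.Γ)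
  | .inl .input => []
  | .inl p => d.port z hold x S p
  | .inr none => []
  | .inr (some k) => (S k).map embed

/-- The configuration of the simulating machine during the simulation proper. -/
def config (x : List Bool) (c : M.Core) (q : d.Q) (z : Bool) (hold : List (Bool ⊕ Option M.Γ))
    (log : List Access) : (d.machine M).Cfg :=
  ⟨⟨some (.sim c.l q z), (c.var, none), d.simStacks z hold x c.stk⟩, log⟩

theorem stepAux_onPorts_push (cond : Port → Bool) (g : M.σ × Option Bool → Bool ⊕ Option M.Γ)
    (s : SimStmt d M) (v) (S : StackIndex M → List (Bool ⊕ Option M.Γ)) :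
    Turing.TM2.stepAux (d.onPorts cond (fun p => .push (.inl p) g) s) v S =
      Turing.TM2.stepAux s v (fun j => match j with
        | .inl .input => S (.inl .input)
        | .inl p => bif cond p then g v :: S (.inl p) else S (.inl p)
        | .inr j => S (.inr j)) := by
  unfold onPorts onPorts.q₁ onPorts.q₂
  cases h₀ : cond .output <;> cases h₁ : cond .query₁ <;> cases h₂ : cond .query₂ <;>
    simp only [cond_true, cond_false, Turing.TM2.stepAux] <;> congr 1 <;> funext j <;>
    rcases j with (_ | _ | _ | _) | j <;> simp [Function.update, h₀, h₁, h₂]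

theorem stepAux_onPorts_pop (cond : Port → Bool)
    (s : SimStmt d M) (v) (S : StackIndex M → List (Bool ⊕ Option M.Γ)) :
    Turing.TM2.stepAux (d.onPorts cond (fun p => .pop (.inl p) fun v _ => v) s) v S =
      Turing.TM2.stepAux s v (fun j => match j with
        | .inl .input => S (.inl .input)
        | .inl p => bif cond p then (S (.inl p)).tail else S (.inl p)
        | .inr j => S (.inr j)) := by
  unfold onPorts onPorts.q₁ onPorts.q₂
  cases h₀ : cond .output <;> cases h₁ : cond .query₁ <;> cases h₂ : cond .query₂ <;>
    simp only [cond_true, cond_false, Turing.TM2.stepAux] <;> congr 1 <;> funext j <;>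
    rcases j with (_ | _ | _ | _) | j <;> simp [Function.update, h₀, h₁, h₂]

theorem port_update (z : Bool) (hold : List (Bool ⊕ Option M.Γ)) (x : List Bool)
    (S : Port ⊕ M.W → List (Bool ⊕ M.Γ)) (k : Port ⊕ M.W) (L) (p : Port) :
    d.port z hold x (Function.update S k L) p =
      bif d.follows z k p then L.map embed else d.port z hold x S p := by
  unfold port follows
  by_cases hp : (decide (p = .output) && z) = true
  · simp only [hp, cond_true]
    rcases k with r | k <;> cases d.route p <;> simp
  · simp only [hp]
    rcases k with r | k <;> cases d.route p <;> simp [Function.update]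
    rename_i r'
    by_cases h : r' = r
    · subst h; simp
    · simp [h, Ne.symm h]

theorem port_of_follows {z : Bool} {k : Port ⊕ M.W} {p : Port} (h : d.follows z k p = true)
    (hold : List (Bool ⊕ Option M.Γ)) (x : List Bool) (S : Port ⊕ M.W → List (Bool ⊕ M.Γ)) :
    d.port z hold x S p = (S k).map embed := by
  unfold port
  unfold follows at h
  rcases k with r | k <;> cases hr : d.route p <;> simp_all
  rcases h.2 with h | h <;> simp [h]

/-- A port that follows `k` holds a copy of it, so pushing or popping there has the same effect as
on the private copy. -/
theorem cond_follows {z : Bool} {k : Port ⊕ M.W} (p : Port)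
    (F : List (Bool ⊕ Option M.Γ) → List (Bool ⊕ Option M.Γ))
    (hold : List (Bool ⊕ Option M.Γ)) (x : List Bool) (S : Port ⊕ M.W → List (Bool ⊕ M.Γ)) :
    (bif d.follows z k p then F (d.port z hold x S p) else d.port z hold x S p) =
      bif d.follows z k p then F ((S k).map embed) else d.port z hold x S p := by
  cases h : d.follows z k p
  · rfl
  · rw [port_of_follows d h]

/-- Each statement acts on the private copy and on every port that follows it, all within one step;
so the simulation of silent steps has no overhead in time. -/
theorem stepAux_translate (q : d.Q) (z : Bool) (hold : List (Bool ⊕ Option M.Γ)) (x : List Bool)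
    (s : Turing.TM2.Stmt (fun _ : Port ⊕ M.W => Bool ⊕ M.Γ) M.Λ M.σ) (v : M.σ) (u : Option Bool)
    (S : Port ⊕ M.W → List (Bool ⊕ M.Γ)) :
    Turing.TM2.stepAux (d.translate q z s) (v, u) (d.simStacks z hold x S) =
      ⟨some (.sim (Turing.TM2.stepAux s v S).l q z), ((Turing.TM2.stepAux s v S).var, u),
        d.simStacks z hold x (Turing.TM2.stepAux s v S).stk⟩ := by
  induction s generalizing v S with
  | push k f s ih =>
    rw [translate, stepAux_onPorts_push, Turing.TM2.stepAux, Turing.TM2.stepAux, ← ih]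
    congr 1
    funext j
    rcases j with (_ | _ | _ | _) | _ | j
    · simp [simStacks]
    iterate 3
      simp only [simStacks, port_update, Function.update, reduceCtorEq, dite_false]
      exact (cond_follows d _ (List.cons (embed (f v))) hold x S).trans (by simp)
    · simp [simStacks, Function.update]
    · by_cases h : j = k
      · subst h; simp [simStacks]
      · simp [simStacks, Function.update, h]
  | peek k f s ih =>
    rw [translate, Turing.TM2.stepAux, Turing.TM2.stepAux, ← ih]
    simp [simStacks, Function.comp_def]
  | pop k f s ih =>
    rw [translate, stepAux_onPorts_pop, Turing.TM2.stepAux, Turing.TM2.stepAux, ← ih]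
    congr 1
    · simp [simStacks, Function.comp_def]
    funext j
    rcases j with (_ | _ | _ | _) | _ | j
    · simp [simStacks]
    iterate 3
      simp only [simStacks, port_update, Function.update, reduceCtorEq, dite_false]
      exact (cond_follows d _ (List.tail) hold x S).trans (by simp)
    · simp [simStacks, Function.update]
    · by_cases h : j = k
      · subst h; simp [simStacks]
      · simp [simStacks, Function.update, h]
  | load f s ih => rw [translate, Turing.TM2.stepAux, Turing.TM2.stepAux, ← ih]
  | branch f s t ihs iht =>
    rw [translate, Turing.TM2.stepAux, Turing.TM2.stepAux]
    cases h : f v <;> simp only [cond_true, cond_false, ihs, iht]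
  | goto f => rfl
  | halt => rfl

/-- The fold makes the last symbol of `out` the outermost statement, hence the first one pushed; the
head of `out` ends up on top. -/
theorem stepAux_finish (acc : Bool) (out : List (Option Bool)) (v : M.σ × Option Bool)
    (S : StackIndex M → List (Bool ⊕ Option M.Γ)) :
    Turing.TM2.stepAux (d.finish (M := M) acc out) v S =
      ⟨none, (v.1, some acc),
        Function.update S (.inl .output) (out.map outSymbol ++ S (.inl .output))⟩ := by
  unfold finish
  induction out using List.reverseRecOn generalizing S with
  | nil => simp [Turing.TM2.stepAux]
  | append_singleton out b ih =>
    rw [List.foldl_append, List.foldl_cons, List.foldl_nil, Turing.TM2.stepAux, ih]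
    simp

end Simulation

end Driver

/-! ### Effect of each action of the control -/

namespace Driver

section Rules

variable (d : Driver) {M : OracleTM} {A B : Language Bool} {x : List Bool} {c : M.Core} {q : d.Q}
  {z : Bool} {hold : List (Bool ⊕ Option M.Γ)} {log : List Access} {n : ℕ} {f : (d.machine M).Cfg}

/-- The word at a port of the simulating machine. -/
def portWord (z : Bool) (hold : List (Bool ⊕ Option M.Γ)) (x : List Bool) (c : M.Core) (p : Port) :
    List Bool := bitPrefix (d.port z hold x c.stk p)

theorem step_config_of_not_settled (h : ¬ M.Settled c) :
    (d.machine M).step A B (d.config x c q z hold log) =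
      d.config x (M.silentStep c) q z hold log := by
  obtain ⟨s, hs⟩ := Option.ne_none_iff_exists'.mp h
  have hp : (d.machine M).program (.sim c.l q z) = .run (d.translate q z s) := by
    simp only [machine, simProgram, hs]
  rw [OracleTM.silentStep_of_silentStmt hs]
  simp only [config, OracleTM.step, hp]
  exact congrArg (OracleTM.Cfg.mk · log) (d.stepAux_translate q z hold x s c.var none c.stk)

theorem program_of_settled (h : M.Settled c) :
    (d.machine M).program (.sim c.l q z) = d.perform c.l z (d.act q (M.event c.l)) := by
  simp only [machine, simProgram, show M.silentStmt c.l = none from h]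

theorem step_config_askFst (h : M.Settled c) {next} (ha : d.act q (M.event c.l) = .askFst next) :
    (d.machine M).step A B (d.config x c q z hold log) =
      d.config x c (next (answer A (d.portWord z hold x c .query₁))) z hold (log ++ [.fst]) := by
  have hp := d.program_of_settled (q := q) (z := z) h
  rw [ha] at hp
  simp only [config, OracleTM.step, hp, perform]
  rfl

theorem step_config_askSnd (h : M.Settled c) {next} (ha : d.act q (M.event c.l) = .askSnd next) :
    (d.machine M).step A B (d.config x c q z hold log) =
      d.config x c (next (answer B (d.portWord z hold x c .query₂))) z hold (log ++ [.snd]) := by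
  have hp := d.program_of_settled (q := q) (z := z) h
  rw [ha] at hp
  simp only [config, OracleTM.step, hp, perform]
  rfl

theorem step_config_askBoth (h : M.Settled c) {next}
    (ha : d.act q (M.event c.l) = .askBoth next) :
    (d.machine M).step A B (d.config x c q z hold log) =
      d.config x c (next (answer A (d.portWord z hold x c .query₁))
        (answer B (d.portWord z hold x c .query₂))) z hold (log ++ [.both]) := by
  have hp := d.program_of_settled (q := q) (z := z) h
  rw [ha] at hp
  simp only [config, OracleTM.step, hp, perform]
  rfl

/-- Taking the current output as the held word changes no port, whether the output was already
frozen, is frozen now, or stays live. -/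
theorem port_hold (z y : Bool) (hold : List (Bool ⊕ Option M.Γ)) (x : List Bool)
    (S : Port ⊕ M.W → List (Bool ⊕ M.Γ)) (p : Port) :
    d.port (z || y) (d.port z hold x S .output) x S p = d.port z hold x S p := by
  cases z <;> cases y <;> cases p <;> simp [port]

theorem step_config_reply (h : M.Settled c) {a b q' y}
    (ha : d.act q (M.event c.l) = .reply a b q' y) :
    (d.machine M).step A B (d.config x c q z hold log) =
      d.config x (M.reply a b c) q' (z || y) (d.port z hold x c.stk .output) log := by
  have hp := d.program_of_settled (q := q) (z := z) h
  rw [ha] at hp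
  simp only [config, OracleTM.step, hp, perform, Turing.TM2.stepAux, OracleTM.reply]
  congr 2
  funext j
  rcases j with (_ | _ | _ | _) | _ | j <;> simp [simStacks, port_hold]

theorem step_config_conclude (h : M.Settled c) {acc out}
    (ha : d.act q (M.event c.l) = .conclude acc out) :
    (d.machine M).step A B (d.config x c q z hold log) =
      ⟨⟨none, (c.var, some (acc (M.accepting c.var))), Function.update
        (d.simStacks z hold x c.stk) (.inl .output)
          ((out (M.accepting c.var)).map outSymbol ++ d.port z hold x c.stk .output)⟩, log⟩ := by
  have hp := d.program_of_settled (q := q) (z := z) h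
  rw [ha] at hp
  simp only [config, OracleTM.step, hp, perform, Turing.TM2.stepAux]
  cases hv : M.accepting c.var <;> simp only [cond_true, cond_false] <;>
    exact congrArg (OracleTM.Cfg.mk · log) (d.stepAux_finish _ _ _ _)

end Rules

/-! ### Distribution of the input -/

section Preamble

variable (d : Driver) (M : OracleTM)

/-- The stacks while the input is being copied: `inp` is unread, `tmp` is on the scratch stack, and
`x` has been copied. -/
def preStacks (inp tmp x : List Bool) : StackIndex M → List (Bool ⊕ Option M.Γ)
  | .inl .input => inp.map .inl
  | .inr none => tmp.map .inl
  | j => d.simStacks false [] x (M.init x).core.stk j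

theorem init_machine (w : List Bool) : (d.machine M).init w =
    ⟨⟨some .start, (M.initialState, none), d.preStacks M w [] []⟩, []⟩ := by
  simp only [OracleTM.init]
  congr 2
  funext j
  rcases j with (_ | _ | _ | _) | _ | j
  · simp [preStacks]; rfl
  iterate 3
    simp only [preStacks, simStacks, port]
    cases d.route _ <;> simp [OracleTM.init] <;> rfl
  · simp [preStacks]; rfl
  · simp [preStacks, simStacks, OracleTM.init]; rfl

theorem stepAux_copyStmt_nil (b u : Option Bool) (x : List Bool) :
    Turing.TM2.stepAux (d.copyStmt M b) (M.initialState, u) (d.preStacks M [] [] x) =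
      ⟨some (.sim (some M.main) (d.start b) false), (M.initialState, none),
        d.simStacks false [] x (M.init x).core.stk⟩ := by
  simp only [copyStmt, Turing.TM2.stepAux, preStacks, List.map_nil, List.head?_nil, readBit,
    Option.isSome_none, cond_false]
  congr 1
  funext j
  rcases j with (_ | _ | _ | _) | _ | j <;> simp [preStacks, simStacks, Function.update]

theorem stepAux_copyStmt_cons (b u : Option Bool) (a : Bool) (tmp x : List Bool) :
    Turing.TM2.stepAux (d.copyStmt M b) (M.initialState, u) (d.preStacks M [] (a :: tmp) x) =
      ⟨some (.copy b), (M.initialState, some a), d.preStacks M [] tmp (a :: x)⟩ := by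
  simp only [copyStmt, Turing.TM2.stepAux, preStacks, List.map_cons, List.head?_cons, readBit,
    Option.isSome_some, cond_true, stepAux_onPorts_push]
  congr 1
  funext j
  rcases j with (_ | _ | _ | _) | _ | j
  · simp [preStacks]
  iterate 3
    simp only [preStacks, simStacks, port, Function.update, reduceCtorEq, dite_false]
    cases d.route _ <;> simp [OracleTM.init]
    rename_i r
    by_cases h : r = .input <;> simp [h, embed]
  · simp [preStacks]
  · by_cases h : j = .inl .input
    · subst h; simp [preStacks, simStacks, OracleTM.init, embed]
    · simp [preStacks, simStacks, OracleTM.init, h, Function.update]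

theorem stepAux_reverseStmt_nil (b u : Option Bool) (tmp : List Bool) :
    Turing.TM2.stepAux (d.reverseStmt M b) (M.initialState, u) (d.preStacks M [] tmp []) =
      ⟨some (.copy b), (M.initialState, none), d.preStacks M [] tmp []⟩ := by
  simp only [reverseStmt, Turing.TM2.stepAux, preStacks, List.map_nil, List.head?_nil, readBit,
    Option.isSome_none, cond_false]
  congr 1
  funext j
  rcases j with (_ | _ | _ | _) | _ | j <;> simp [preStacks, simStacks, Function.update]

theorem stepAux_reverseStmt_cons (b u : Option Bool) (a : Bool) (inp tmp : List Bool) :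
    Turing.TM2.stepAux (d.reverseStmt M b) (M.initialState, u)
        (d.preStacks M (a :: inp) tmp []) =
      ⟨some (.reverse b), (M.initialState, some a), d.preStacks M inp (a :: tmp) []⟩ := by
  simp only [reverseStmt, Turing.TM2.stepAux, preStacks, List.map_cons, List.head?_cons, readBit,
    Option.isSome_some, cond_true]
  congr 1
  funext j
  rcases j with (_ | _ | _ | _) | _ | j <;> simp [preStacks, simStacks, Function.update]

/-- The input of the simulated machine, given the input of the simulating machine. -/
def inputWord (w : List Bool) : List Bool := bif d.skip then w.tail else w

/-- The letter that is handed to the control. -/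
def firstLetter (w : List Bool) : Option Bool := bif d.skip then w.head? else none

theorem length_inputWord_le (w : List Bool) : (d.inputWord w).length ≤ w.length := by
  unfold inputWord; cases d.skip <;> simp

theorem stepAux_startStmt (w : List Bool) : ∃ u,
    Turing.TM2.stepAux (d.startStmt M) (M.initialState, none) (d.preStacks M w [] []) =
      ⟨some (.reverse (d.firstLetter w)), (M.initialState, u),
        d.preStacks M (d.inputWord w) [] []⟩ := by
  cases hs : d.skip with
  | false => exact ⟨none, by simp only [startStmt, hs, inputWord, firstLetter]; rfl⟩
  | true =>
    have hr : readBit (List.head? (w.map (Sum.inl : Bool → Bool ⊕ Option M.Γ))) = w.head? := by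
      cases w <;> rfl
    refine ⟨w.head?, ?_⟩
    simp only [startStmt, hs, inputWord, firstLetter, cond_true, Turing.TM2.stepAux, preStacks, hr]
    congr 1
    funext j
    rcases j with (_ | _ | _ | _) | _ | j <;> simp [preStacks, simStacks, Function.update]

variable {d M} {A B : Language Bool} {n : ℕ} {f : (d.machine M).Cfg} {b : Option Bool}

theorem haltsIn_of_stepAux {l : Label M.Λ d.Q} {s : SimStmt d M} {v S}
    {c : Turing.TM2.Cfg (fun _ : StackIndex M => Bool ⊕ Option M.Γ) (Label M.Λ d.Q)
      (M.σ × Option Bool)} (hp : d.simProgram M l = .run s)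
    (hs : Turing.TM2.stepAux s v S = c) (h : (d.machine M).HaltsIn A B n ⟨c, []⟩ f) :
    (d.machine M).HaltsIn A B (n + 1) ⟨⟨some l, v, S⟩, []⟩ f := by
  apply OracleTM.HaltsIn.of_step
  have hp : (d.machine M).program l = .run s := hp
  simp only [OracleTM.step, hp]
  rw [← hs] at h
  exact h

theorem haltsIn_copy (u : Option Bool) (tmp x : List Bool)
    (h : (d.machine M).HaltsIn A B n (d.config (tmp.reverse ++ x)
      (M.init (tmp.reverse ++ x)).core (d.start b) false [] []) f) :
    (d.machine M).HaltsIn A B (n + tmp.length + 1)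
      ⟨⟨some (.copy b), (M.initialState, u), d.preStacks M [] tmp x⟩, []⟩ f := by
  induction tmp generalizing u x with
  | nil => exact haltsIn_of_stepAux rfl (d.stepAux_copyStmt_nil M b u x) h
  | cons a tmp ih =>
    exact haltsIn_of_stepAux rfl (d.stepAux_copyStmt_cons M b u a tmp x)
      (ih (some a) (a :: x) (by simpa using h))

theorem haltsIn_reverse (u : Option Bool) (inp tmp : List Bool)
    (h : ∀ u, (d.machine M).HaltsIn A B n
      ⟨⟨some (.copy b), (M.initialState, u), d.preStacks M [] (inp.reverse ++ tmp) []⟩, []⟩ f) :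
    (d.machine M).HaltsIn A B (n + inp.length + 1)
      ⟨⟨some (.reverse b), (M.initialState, u), d.preStacks M inp tmp []⟩, []⟩ f := by
  induction inp generalizing u tmp with
  | nil => exact haltsIn_of_stepAux rfl (d.stepAux_reverseStmt_nil M b u tmp) (h none)
  | cons a inp ih =>
    exact haltsIn_of_stepAux rfl (d.stepAux_reverseStmt_cons M b u a inp tmp)
      (ih (some a) (a :: tmp) (by simpa using h))

/-- Reversing and copying take one step per letter each; the `3` counts the start and the two steps
that detect an empty stack. -/
theorem haltsIn_init_machine (w : List Bool)
    (h : (d.machine M).HaltsIn A B n (d.config (d.inputWord w) (M.init (d.inputWord w)).core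
      (d.start (d.firstLetter w)) false [] []) f) :
    (d.machine M).HaltsIn A B (n + 2 * w.length + 3) ((d.machine M).init w) f := by
  obtain ⟨u, hu⟩ := d.stepAux_startStmt M w
  have hl := d.length_inputWord_le w
  rw [init_machine]
  refine OracleTM.HaltsIn.mono
    (n := n + (d.inputWord w).length + 1 + (d.inputWord w).length + 1 + 1)
    (haltsIn_of_stepAux rfl hu (haltsIn_reverse u _ _ fun u => ?_)) (by omega)
  have := haltsIn_copy (A := A) (B := B) (n := n) (f := f) (d := d) (b := d.firstLetter w) u
    ((d.inputWord w).reverse ++ []) [] (by simpa using h)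
  simpa using this

end Preamble
end Driver
-- Time accounting and the resulting clocked machine
theorem eval_le_eval (p : Polynomial ℕ) {m n : ℕ} (h : m ≤ n) : p.eval m ≤ p.eval n := by
  rw [Polynomial.eval_eq_sum, Polynomial.eval_eq_sum]
  exact Finset.sum_le_sum fun i _ => Nat.mul_le_mul_left _ (Nat.pow_le_pow_left h i)

namespace Driver

section Rules

variable (d : Driver) (M : DPTM)

/-- Starting from an event of `M`, the simulation of `M` on `x` halts within `m` steps and `k`
silent computations of `M`, and its log, verdict and output satisfy `P`. -/
def Ends (A B : Language Bool) (x : List Bool) (k m : ℕ) (c : M.Core) (q : d.Q) (z : Bool)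
    (hold : List (Bool ⊕ Option M.Γ)) (log : List Access)
    (P : List Access → Bool → List Bool → Prop) : Prop :=
  ∃ f : (d.machine M.toOracleTM).Cfg,
    (d.machine M.toOracleTM).HaltsIn A B (k * M.clock.eval x.length + m)
      (d.config x c q z hold log) f ∧
    P f.log ((d.machine M.toOracleTM).accepting f.core.var)
      (bitPrefix (f.core.stk (.inl .output)))

variable {d M} {A B : Language Bool} {x : List Bool} {c : M.Core} {q : d.Q}
  {z : Bool} {hold : List (Bool ⊕ Option M.Γ)} {log : List Access} {k m n : ℕ}
  {P : List Access → Bool → List Bool → Prop}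

theorem haltsIn_settle {f : (d.machine M.toOracleTM).Cfg}
    (h : (d.machine M.toOracleTM).HaltsIn A B n (d.config x (M.settle x c) q z hold log) f) :
    (d.machine M.toOracleTM).HaltsIn A B (n + M.clock.eval x.length)
      (d.config x c q z hold log) f := by
  unfold DPTM.settle at h
  generalize M.clock.eval x.length = m at h ⊢
  induction m generalizing c with
  | zero => exact h
  | succ m ih =>
    rw [Function.iterate_succ_apply] at h
    by_cases hc : M.Settled c
    · rw [OracleTM.silentStep_of_settled hc] at h
      exact (ih h).mono (by omega)
    · have := ih h
      rw [← step_config_of_not_settled d hc] at this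
      exact this.of_step

theorem ends_askFst (hc : M.Settled c) {next} (ha : d.act q (M.event c.l) = .askFst next)
    (h : d.Ends M A B x k m c (next (answer A (d.portWord z hold x c .query₁))) z hold
      (log ++ [.fst]) P) :
    d.Ends M A B x k (m + 1) c q z hold log P := by
  obtain ⟨f, hf, hP⟩ := h
  rw [← step_config_askFst d hc ha] at hf
  exact ⟨f, hf.of_step, hP⟩

theorem ends_askSnd (hc : M.Settled c) {next} (ha : d.act q (M.event c.l) = .askSnd next)
    (h : d.Ends M A B x k m c (next (answer B (d.portWord z hold x c .query₂))) z hold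
      (log ++ [.snd]) P) :
    d.Ends M A B x k (m + 1) c q z hold log P := by
  obtain ⟨f, hf, hP⟩ := h
  rw [← step_config_askSnd d hc ha] at hf
  exact ⟨f, hf.of_step, hP⟩

theorem ends_askBoth (hc : M.Settled c) {next} (ha : d.act q (M.event c.l) = .askBoth next)
    (h : d.Ends M A B x k m c (next (answer A (d.portWord z hold x c .query₁))
      (answer B (d.portWord z hold x c .query₂))) z hold (log ++ [.both]) P) :
    d.Ends M A B x k (m + 1) c q z hold log P := by
  obtain ⟨f, hf, hP⟩ := h
  rw [← step_config_askBoth d hc ha] at hf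
  exact ⟨f, hf.of_step, hP⟩

theorem ends_reply (hc : M.Settled c) {a b q' y}
    (ha : d.act q (M.event c.l) = .reply a b q' y)
    (h : d.Ends M A B x k m (M.settle x (M.reply a b c)) q' (z || y)
      (d.port z hold x c.stk .output) log P) :
    d.Ends M A B x (k + 1) (m + 1) c q z hold log P := by
  obtain ⟨f, hf, hP⟩ := h
  have hf := haltsIn_settle hf
  rw [← step_config_reply d hc ha] at hf
  exact ⟨f, hf.of_step.mono (by rw [Nat.succ_mul]; omega), hP⟩

theorem ends_conclude (hc : M.Settled c) {acc out} (ha : d.act q (M.event c.l) = .conclude acc out)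
    (hP : P log (acc (M.accepting c.var)) (bitPrefix ((out (M.accepting c.var)).map outSymbol ++
      d.port z hold x c.stk .output))) :
    d.Ends M A B x k (m + 1) c q z hold log P := by
  refine ⟨_, OracleTM.HaltsIn.of_step ⟨0, Nat.zero_le _, rfl, ?_⟩, ?_⟩
  · rw [Function.iterate_zero_apply, step_config_conclude d hc ha]
  · rw [Function.iterate_zero_apply, step_config_conclude d hc ha]
    have := Function.update_self (β := fun _ => List (Bool ⊕ Option M.Γ))
      (Sum.inl Port.output : StackIndex M.toOracleTM)
      ((out (M.accepting c.var)).map outSymbol ++ d.port z hold x c.stk .output)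
      (d.simStacks z hold x c.stk)
    rw [← this] at hP
    exact hP

theorem portWord_stack {p r : Port} (hp : p ≠ .output) (h : d.route p = .stack r) :
    d.portWord z hold x c p = M.word c r := by
  simp [portWord, port, hp, h, bitPrefix_map_embed, OracleTM.word]

theorem portWord_word {p : Port} (hp : p ≠ .output) (h : d.route p = .word) :
    d.portWord z hold x c p = x := by
  have := bitPrefix_map_inl (Γ := Option M.Γ) x []
  simp_all [portWord, port, bitPrefix]

end Rules

section Construction

variable (d : Driver) (M : DPTM)

/-- The simulation of `M` under the control of `d` on the input `w` ends in time, and its log,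
verdict and output satisfy `P`. -/
def Yields (A B : Language Bool) (w : List Bool) (P : List Access → Bool → List Bool → Prop) :
    Prop :=
  d.Ends M A B (d.inputWord w) 2 10 (M.first (d.inputWord w)) (d.start (d.firstLetter w))
    false [] [] P

/-- Termination under all oracles is needed to have a machine at all; any further property, for
particular oracles, is then read off the same run. -/
theorem exists_dptm (h : ∀ A B w, d.Yields M A B w fun _ _ _ => True) :
    ∃ N : DPTM, ∀ A B w P, d.Yields M A B w P →
      P (N.accesses A B w) (N.accepting (N.final A B w).core.var) (N.output A B w) := by
  -- Three silent computations (one before the first event, two after replies), `2 * |w| + 3` steps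
  -- for distributing the input, and `10` steps for the actions.
  let p : Polynomial ℕ := 3 * M.clock + 2 * Polynomial.X + Polynomial.C 13
  have hp (A B w f) (hf : (d.machine M.toOracleTM).HaltsIn A B
      (2 * M.clock.eval (d.inputWord w).length + 10) (d.config (d.inputWord w)
        (M.first (d.inputWord w)) (d.start (d.firstLetter w)) false [] []) f) :
      (d.machine M.toOracleTM).runFor A B (p.eval w.length) w = f ∧ f.core.l = none := by
    have h₁ := eval_le_eval M.clock (d.length_inputWord_le w)
    have h₂ := (haltsIn_init_machine w (haltsIn_settle hf)).mono (m := p.eval w.length)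
      (by simp [p]; omega)
    obtain ⟨-, -, -, hn⟩ := hf
    exact ⟨h₂.iterate_eq, hn⟩
  refine ⟨⟨d.machine M.toOracleTM, p, fun A B w => ?_⟩, fun A B w P ho => ?_⟩
  · obtain ⟨f, hf, -⟩ := h A B w
    obtain ⟨h₁, h₂⟩ := hp A B w f hf
    rwa [h₁]
  · obtain ⟨f, hf, hP⟩ := ho
    obtain ⟨h₁, h₂⟩ := hp A B w f hf
    rw [← h₁] at hP
    exact hP

end Construction

end Driver

/-! ### Runs with restricted oracle access -/

namespace DPTM

variable {M : DPTM} {A B : Language Bool}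

theorem first_settled (x : List Bool) : M.Settled (M.first x) := stage_settled x false false 0

theorem settle_reply_settled (x : List Bool) (a b : Bool) :
    M.Settled (M.settle x (M.reply a b (M.first x))) := stage_settled x a b 1

theorem settle_reply_reply_settled (x : List Bool) (a b : Bool) :
    M.Settled (M.settle x (M.reply a b (M.settle x (M.reply a b (M.first x))))) :=
  stage_settled x a b 2

theorem next_settled (A B : Language Bool) (x : List Bool) :
    M.Settled (M.next A B x (M.first x)) := settle_reply_settled x _ _

theorem settle_of_settled (x : List Bool) {c : M.Core} (h : M.Settled c) : M.settle x c = c :=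
  Function.iterate_fixed (OracleTM.silentStep_of_settled h) _

theorem settle_reply_of_halt (x : List Bool) {c : M.Core} (h : M.Settled c)
    (he : M.event c.l = .halt) (a b : Bool) : M.settle x (M.reply a b c) = c := by
  rw [OracleTM.reply_of_event_eq_halt he, settle_of_settled x h]

theorem final_core_of_isParallel (h : M.IsParallel A B) (x : List Bool) :
    (M.final A B x).core = M.next A B x (M.first x) := by
  have h₀ := haltsIn_settle_init (M := M) A B x
  have s₀ := first_settled (M := M) x
  have s₁ := next_settled (M := M) A B x
  have h₁ := haltsIn_next s₀ h₀
  have h₂ := haltsIn_next s₁ h₁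
  have hl := h₂.log_prefix.length_le.trans (h x)
  -- A second oracle step would give a log of length two; and if the first event is halting, `next`
  -- does not move.
  have he : M.event (M.next A B x (M.first x)).l = .halt := by
    cases e₁ : M.event (M.next A B x (M.first x)).l <;> try rfl
    all_goals
      cases e₀ : M.event (M.first x).l <;> simp only [e₀, e₁, Event.log] at hl <;> try
        simp at hl
      rw [next, settle_reply_of_halt x s₀ e₀, e₀] at e₁
      cases e₁
  rw [← h₁.eq_of_l_eq_none (OracleTM.eq_none_of_event_eq_halt s₁ he)]

theorem final_core_of_isOrdered (h : M.IsOrdered A B) (x : List Bool) :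
    (M.final A B x).core = M.next A B x (M.next A B x (M.first x)) ∧
    (M.event (M.first x).l = .halt ∨
      M.event (M.first x).l = .fst ∧ M.event (M.next A B x (M.first x)).l = .halt ∨
      M.event (M.first x).l = .fst ∧ M.event (M.next A B x (M.first x)).l = .snd ∨
      M.event (M.first x).l = .snd ∧ M.event (M.next A B x (M.first x)).l = .halt) := by
  have h₀ := haltsIn_settle_init (M := M) A B x
  have s₀ := first_settled (M := M) x
  have s₁ := next_settled (M := M) A B x
  have h₁ := haltsIn_next s₀ h₀
  have h₂ := haltsIn_next s₁ h₁
  have s₂ := settled_next_of_haltsIn s₁ h₁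
  have h₃ := haltsIn_next s₂ h₂
  have hl := h₃.log_prefix.sublist.trans (h x)
  have hc : M.event (M.first x).l = .halt ∨
      M.event (M.first x).l = .fst ∧ M.event (M.next A B x (M.first x)).l = .halt ∨
      M.event (M.first x).l = .fst ∧ M.event (M.next A B x (M.first x)).l = .snd ∨
      M.event (M.first x).l = .snd ∧ M.event (M.next A B x (M.first x)).l = .halt := by
    have hl := h₂.log_prefix.sublist.trans (h x)
    change List.Sublist ([] ++ (M.event (M.first x).l).log ++
      (M.event (M.next A B x (M.first x)).l).log) _ at hl
    cases e₀ : M.event (M.first x).l <;> cases e₁ : M.event (M.next A B x (M.first x)).l <;>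
      simp [e₀, e₁, Event.log, List.sublist_cons_iff] at hl ⊢
  refine ⟨?_, hc⟩
  -- Only after `fst` and `snd` is the log needed again: a third oracle step would make it too long.
  have he : M.event (M.next A B x (M.next A B x (M.first x))).l = .halt := by
    change List.Sublist ([] ++ (M.event (M.first x).l).log ++
      (M.event (M.next A B x (M.first x)).l).log ++
      (M.event (M.next A B x (M.next A B x (M.first x))).l).log) _ at hl
    have hn (c : M.Core) (hs : M.Settled c) (he : M.event c.l = .halt) :
        M.next A B x c = c := settle_reply_of_halt x hs he _ _
    rcases hc with e | ⟨e, e'⟩ | ⟨e, e'⟩ | ⟨e, e'⟩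
    · rw [hn _ s₀ e, hn _ s₀ e, e]
    · rw [hn _ s₁ e', e']
    · rw [e, e'] at hl
      have hl := hl.length_le
      cases e₂ : M.event (M.next A B x (M.next A B x (M.first x))).l <;>
        simp [e₂, Event.log] at hl ⊢
    · rw [hn _ s₁ e', e']
  rw [← h₂.eq_of_l_eq_none (OracleTM.eq_none_of_event_eq_halt s₂ he)]

end DPTM

/-! ### The controls used in the inclusions -/

namespace Driver

/-- Ask both oracles one after the other, then continue the simulated machine once; `swap` exchanges
the roles of the oracles. -/
def serial (swap : Bool) : Driver where
  Q := Fin 4 × Bool × Bool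
  skip := false
  start _ := (0, false, false)
  route
    | .query₁ => .stack (bif swap then .query₂ else .query₁)
    | .query₂ => .stack (bif swap then .query₁ else .query₂)
    | _ => .nothing
  act q _ := match q with
    | (0, _, _) => .askFst fun a => (1, a, false)
    | (1, a, _) => .askSnd fun b => (2, a, b)
    | (2, a, b) => .reply (bif swap then b else a) (bif swap then a else b) (3, a, b) false
    | (3, _, _) => .conclude id fun _ => []

/-- Both questions are asked whatever the first event is, since both query words are already present
there; the reply ignores an answer that was not wanted. -/
theorem serial_yields (M : DPTM) (A B : Language Bool) (x : List Bool) :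
    (serial false).Yields M A B x fun log acc _ =>
      log = [.fst, .snd] ∧ acc = M.accepting (M.next A B x (M.first x)).var := by
  have hs := DPTM.first_settled (M := M) x
  refine ends_askFst hs rfl ?_
  refine ends_askSnd hs rfl ?_
  refine ends_reply hs rfl ?_
  refine ends_conclude (DPTM.settle_reply_settled x _ _) rfl ⟨rfl, ?_⟩
  rw [portWord_stack (p := .query₁) (r := .query₁) (by simp) rfl,
    portWord_stack (p := .query₂) (r := .query₂) (by simp) rfl]
  rfl

theorem serial_swap_yields (M : DPTM) (A B : Language Bool) (x : List Bool) :
    (serial true).Yields M B A x fun log acc _ =>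
      log = [.fst, .snd] ∧ acc = M.accepting (M.next A B x (M.first x)).var := by
  have hs := DPTM.first_settled (M := M) x
  refine ends_askFst hs rfl ?_
  refine ends_askSnd hs rfl ?_
  refine ends_reply hs rfl ?_
  refine ends_conclude (DPTM.settle_reply_settled x _ _) rfl ⟨rfl, ?_⟩
  rw [portWord_stack (p := .query₁) (r := .query₂) (by simp) rfl,
    portWord_stack (p := .query₂) (r := .query₁) (by simp) rfl]
  rfl

/-- Answer a first query to the first oracle truthfully, and output the word on the second query
stack at the next event. -/
def secondQuery : Driver where
  Q := Fin 3 × Bool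
  skip := false
  start _ := (0, false)
  route
    | .query₁ => .stack .query₁
    | .output => .stack .query₂
    | _ => .nothing
  act q e := match q, e with
    | (0, _), .fst => .askFst fun a => (1, a)
    | (1, a), _ => .reply a a (2, a) false
    | _, _ => .conclude id fun _ => []

/-- The configuration in which `secondQuery` stops. -/
noncomputable def secondQueryCore (M : DPTM) (A : Language Bool) (x : List Bool) : M.Core :=
  match M.event (M.first x).l with
  | .fst => M.settle x (M.reply (answer A (M.word (M.first x) .query₁))
      (answer A (M.word (M.first x) .query₁)) (M.first x))
  | _ => M.first x

/-- When the first event is not `fst`, the run stops there without any query, which covers machines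
that go straight to their second oracle. -/
theorem secondQuery_yields (M : DPTM) (A B : Language Bool) (x : List Bool) :
    secondQuery.Yields M A B x fun log _ out =>
      log.Sublist [.fst] ∧ out = M.word (secondQueryCore M A x) .query₂ := by
  have hs := DPTM.first_settled (M := M) x
  have ho (c : M.Core) : bitPrefix ([] ++ secondQuery.port (M := M.toOracleTM) false [] x c.stk
      .output) = M.word c .query₂ := bitPrefix_map_embed _
  unfold Yields
  rw [show secondQuery.inputWord x = x from rfl]
  cases he : M.event (M.first x).l with
  | fst =>
    refine ends_askFst (next := fun a => (1, a)) hs (by rw [he]; rfl) ?_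
    refine ends_reply hs rfl ?_
    refine ends_conclude (DPTM.settle_reply_settled x _ _) rfl ⟨by simp, (ho _).trans ?_⟩
    rw [portWord_stack (r := .query₁) (by simp) rfl, secondQueryCore, he]
  | _ =>
    refine ends_conclude (acc := id) (out := fun _ => []) hs (by rw [he]; rfl)
      ⟨by simp, (ho _).trans ?_⟩
    rw [secondQueryCore, he]

/-- Ask both oracles at once, the first one about the input, and give their answers, in exchanged
roles, to the simulated machine. -/
def parallelSwap : Driver where
  Q := Fin 4 × Bool × Bool
  skip := false
  start _ := (0, false, false)
  route
    | .query₁ => .word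
    | .query₂ => .stack .query₁
    | _ => .nothing
  act q _ := match q with
    | (0, _, _) => .askBoth fun a b => (1, a, b)
    | (1, a, b) => .reply b a (2, a, b) false
    | (2, a, b) => .reply b a (3, a, b) false
    | (3, _, _) => .conclude id fun _ => []

/-- The same pair of answers is given twice because the simulated machine may make two oracle steps;
each step uses only its own component. -/
theorem parallelSwap_yields (M : DPTM) (A B : Language Bool) (x : List Bool) :
    parallelSwap.Yields M A B x fun log acc _ => log = [.both] ∧
      acc = M.accepting (M.settle x (M.reply (answer B (M.word (M.first x) .query₁)) (answer A x)
        (M.settle x (M.reply (answer B (M.word (M.first x) .query₁)) (answer A x)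
          (M.first x))))).var := by
  have hs := DPTM.first_settled (M := M) x
  refine ends_askBoth hs rfl ?_
  refine ends_reply hs rfl ?_
  refine ends_reply (DPTM.settle_reply_settled x _ _) rfl ?_
  refine ends_conclude (DPTM.settle_reply_reply_settled x _ _) rfl ⟨rfl, ?_⟩
  rw [portWord_word (p := .query₁) (by simp) rfl, portWord_stack (r := .query₁) (by simp) rfl]
  rfl

/-! ### Verdicts under a guessed first answer -/

section Guess

/-- The next settled configuration if a query to the first oracle is made and is answered by `a`. -/
def guess (M : DPTM) (a : Bool) (x : List Bool) : M.Core :=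
  match M.event (M.first x).l with
  | .fst => M.settle x (M.reply a a (M.first x))
  | _ => M.first x

/-- The settled configuration after a query to the second oracle, if queries to the first oracle are
answered by `a`. -/
noncomputable def guessNext (M : DPTM) (a : Bool) (B : Language Bool) (x : List Bool) : M.Core :=
  M.settle x (M.reply a (answer B (M.word (guess M a x) .query₂)) (guess M a x))

/-- The verdict if queries to the first oracle are answered by `a`. -/
noncomputable def guessVerdict (M : DPTM) (a : Bool) (B : Language Bool) (x : List Bool) : Bool :=
  M.accepting (guessNext M a B x).var

variable {M : DPTM} {x : List Bool}

theorem guess_of_fst (he : M.event (M.first x).l = .fst) (a b : Bool) :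
    guess M a x = M.settle x (M.reply a b (M.first x)) := by
  rw [guess, he, OracleTM.reply_of_event_eq_fst he a a b]

theorem guess_of_ne_fst (he : M.event (M.first x).l ≠ .fst) (a : Bool) :
    guess M a x = M.first x := by
  unfold guess
  split
  · contradiction
  · rfl

/-- The guess leaves the second answer of its reply free; with `b` there, both replies agree with
constant oracles `a` and `b`. -/
theorem settle_reply_guess_settled (a b : Bool) :
    M.Settled (M.settle x (M.reply a b (guess M a x))) := by
  by_cases he : M.event (M.first x).l = .fst
  · rw [guess_of_fst he a b]; exact DPTM.settle_reply_reply_settled x a b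
  · rw [guess_of_ne_fst he]; exact DPTM.settle_reply_settled x a b

/-- A correct guess reproduces the true run. Without a query to the first oracle every guess is
correct, hence the conditional hypothesis. -/
theorem final_core_eq_guessNext {A B : Language Bool} (h : M.IsOrdered A B) {a : Bool}
    (ha : M.event (M.first x).l = .fst → a = answer A (M.word (M.first x) .query₁)) :
    (M.final A B x).core = guessNext M a B x := by
  obtain ⟨hf, hc⟩ := DPTM.final_core_of_isOrdered h x
  have s₀ := DPTM.first_settled (M := M) x
  have s₁ := DPTM.next_settled (M := M) A B x
  rw [hf, guessNext]
  have hn (c : M.Core) (hs : M.Settled c) (he : M.event c.l = .halt) :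
    M.next A B x c = c := DPTM.settle_reply_of_halt x hs he _ _
  have hg (he : M.event (M.first x).l = .fst) : guess M a x = M.next A B x (M.first x) := by
    rw [guess_of_fst he a (answer B (M.word (M.first x) .query₂)), ha he]; rfl
  rcases hc with e | ⟨e, e'⟩ | ⟨e, e'⟩ | ⟨e, e'⟩
  · rw [guess_of_ne_fst (by simp [e]), DPTM.settle_reply_of_halt x s₀ e, hn _ s₀ e, hn _ s₀ e]
  · rw [hg e, DPTM.settle_reply_of_halt x s₁ e', hn _ s₁ e']
  · rw [hg e, OracleTM.reply_of_event_eq_snd e' a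
      (answer A (M.word (M.next A B x (M.first x)) .query₁))]
    rfl
  · rw [guess_of_ne_fst (by simp [e]), hn _ s₁ e', OracleTM.reply_of_event_eq_snd e a
      (answer A (M.word (M.first x) .query₁))]
    rfl

end Guess

/-- Answer a first query to the first oracle by `a`, ask the second oracle of the simulated machine
truthfully, and determine the output from the verdict. -/
def probe (a skip : Bool) (source : Source) (out : Bool → Bool → List (Option Bool)) : Driver where
  Q := Fin 4 × Bool × Bool
  skip := skip
  start o := (0, o.getD false, false)
  route
    | .query₁ => .stack .query₂
    | .output => source
    | _ => .nothing
  act q e := match q, e with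
    | (0, c, b), .fst => .reply a a (1, c, b) true
    | (0, c, _), _ => .askFst fun b => (2, c, b)
    | (1, c, _), _ => .askFst fun b => (2, c, b)
    | (2, c, b), _ => .reply a b (3, c, b) false
    | (3, c, _), _ => .conclude id (out c)

/-- Here `B` is the first oracle of the simulating machine but answers the second queries of `M`.
What lies below `out` is specified only where it is used: after a `fst` event, or when the output
carries the input word. -/
theorem probe_yields (M : DPTM) (a skip : Bool) (source : Source)
    (out : Bool → Bool → List (Option Bool)) (B E : Language Bool) (w : List Bool) :
    (probe a skip source out).Yields M B E w fun log _ word => log = [.fst] ∧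
      ∀ x, (probe a skip source out).inputWord w = x → ∃ rest : List (Bool ⊕ Option M.Γ),
        word = bitPrefix ((out (((probe a skip source out).firstLetter w).getD false)
          (guessVerdict M a B x)).map outSymbol ++ rest) ∧
        (M.event (M.first x).l = .fst ∨ source = .word →
          rest = (probe a skip source out).port (M := M.toOracleTM) false [] x (M.first x).stk
            .output) := by
  unfold Yields
  generalize (probe a skip source out).inputWord w = x
  generalize hb : (probe a skip source out).firstLetter w = b
  have hs := DPTM.first_settled (M := M) x
  by_cases he : M.event (M.first x).l = .fst
  -- Freezing preserves what the output port holds at the first query while the simulation goes on.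
  · refine ends_reply (a := a) (b := a) (y := true) (q' := (1, b.getD false, false)) hs
      (by rw [he]; rfl) ?_
    refine ends_askFst (DPTM.settle_reply_settled x _ _) rfl ?_
    refine ends_reply (DPTM.settle_reply_settled x _ _) rfl ?_
    refine ends_conclude ?_ rfl ⟨rfl, ?_⟩
    · rw [← guess_of_fst he]
      exact settle_reply_guess_settled a _
    · rintro _ rfl
      refine ⟨_, ?_, fun _ => rfl⟩
      rw [portWord_stack (r := .query₂) (by simp) rfl, ← guess_of_fst he]
      rfl
  · refine ends_askFst (next := fun b' => (2, b.getD false, b')) hs ?_ ?_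
    · cases e : M.event (M.first x).l <;> first | rfl | contradiction
    refine ends_reply hs rfl ?_
    refine ends_conclude (DPTM.settle_reply_settled x _ _) rfl ⟨rfl, ?_⟩
    rintro _ rfl
    rw [portWord_stack (r := .query₂) (by simp) rfl, guessVerdict, guessNext, guess_of_ne_fst he]
    refine ⟨_, rfl, ?_⟩
    rintro (h | h)
    · contradiction
    · subst h
      rfl

/-- Answer a first query to the first oracle by `a`, ask the second oracle truthfully and at the
same time the first oracle about the input, and combine its answer with the verdict. -/
def parallelProbe (a : Bool) (acc : Bool → Bool → Bool) : Driver where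
  Q := Fin 4 × Bool × Bool
  skip := false
  start _ := (0, false, false)
  route
    | .query₁ => .word
    | .query₂ => .stack .query₂
    | _ => .nothing
  act q e := match q, e with
    | (0, c, b), .fst => .reply a a (1, c, b) true
    | (0, _, _), _ => .askBoth fun c b => (2, c, b)
    | (1, _, _), _ => .askBoth fun c b => (2, c, b)
    | (2, c, b), _ => .reply a b (3, c, b) false
    | (3, c, _), _ => .conclude (acc c) fun _ => []

theorem parallelProbe_yields (M : DPTM) (a : Bool) (acc : Bool → Bool → Bool)
    (A B : Language Bool) (x : List Bool) :
    (parallelProbe a acc).Yields M A B x fun log acc' _ =>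
      log = [.both] ∧ acc' = acc (answer A x) (guessVerdict M a B x) := by
  have hs := DPTM.first_settled (M := M) x
  unfold Yields
  rw [show (parallelProbe a acc).inputWord x = x from rfl]
  by_cases he : M.event (M.first x).l = .fst
  · refine ends_reply (a := a) (b := a) (y := true) (q' := (1, false, false)) hs
      (by rw [he]; rfl) ?_
    refine ends_askBoth (DPTM.settle_reply_settled x _ _) rfl ?_
    refine ends_reply (DPTM.settle_reply_settled x _ _) rfl ?_
    refine ends_conclude ?_ rfl ⟨rfl, ?_⟩
    · rw [← guess_of_fst he]
      exact settle_reply_guess_settled a _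
    · rw [portWord_word (by simp) rfl, portWord_stack (r := .query₂) (by simp) rfl,
        ← guess_of_fst he]
      rfl
  · refine ends_askBoth (next := fun c b => (2, c, b)) hs ?_ ?_
    · cases e : M.event (M.first x).l <;> first | rfl | contradiction
    refine ends_reply hs rfl ?_
    refine ends_conclude (DPTM.settle_reply_settled x _ _) rfl ⟨rfl, ?_⟩
    rw [portWord_word (by simp) rfl, portWord_stack (r := .query₂) (by simp) rfl,
      guessVerdict, guessNext, guess_of_ne_fst he]

end Driver

/-! ### The four inclusions -/

open Driver

variable {𝒞 𝒟 : ComplexityClass}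

theorem POrdered_of_parallel {M N : DPTM} {A B A' B' : Language Bool} (hM : M.IsParallel A B)
    (hN : ∀ x, N.accesses A' B' x = [.fst, .snd] ∧
      N.accepting (N.final A' B' x).core.var = M.accepting (M.next A B x (M.first x)).var) :
    N.IsOrdered A' B' ∧ M.acceptedLanguage A B = N.acceptedLanguage A' B' := by
  refine ⟨fun x => by rw [(hN x).1], Set.ext fun x => ?_⟩
  change M.accepting _ = true ↔ N.accepting _ = true
  rw [(hN x).2, DPTM.final_core_of_isParallel hM]

theorem PParallel_subset_POrdered (𝒞 𝒟 : ComplexityClass) : PParallel 𝒞 𝒟 ⊆ POrdered 𝒞 𝒟 := by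
  rintro _ ⟨C, hC, D, hD, M, hM, rfl⟩
  obtain ⟨N, hN⟩ := (serial false).exists_dptm M fun A B w =>
    (serial_yields M A B w).imp fun _ h => ⟨h.1, trivial⟩
  exact ⟨C, hC, D, hD, N, POrdered_of_parallel hM fun x => hN _ _ _ _ (serial_yields M C D x)⟩

theorem PParallel_subset_POrdered_swap (𝒞 𝒟 : ComplexityClass) :
    PParallel 𝒞 𝒟 ⊆ POrdered 𝒟 𝒞 := by
  rintro _ ⟨C, hC, D, hD, M, hM, rfl⟩
  obtain ⟨N, hN⟩ := (serial true).exists_dptm M fun A B w =>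
    (serial_swap_yields M B A w).imp fun _ h => ⟨h.1, trivial⟩
  exact ⟨D, hD, C, hC, N,
    POrdered_of_parallel hM fun x => hN _ _ _ _ (serial_swap_yields M C D x)⟩

theorem POrdered_swap_subset_PParallel (hdown : ClosedDownwardOneQuery 𝒞 𝒟) :
    POrdered 𝒟 𝒞 ⊆ PParallel 𝒞 𝒟 := by
  rintro _ ⟨D, hD, C, hC, M, hM, rfl⟩
  obtain ⟨F, hF⟩ := secondQuery.exists_dptm M fun A B w =>
    (secondQuery_yields M A B w).imp fun _ h => ⟨h.1, trivial⟩
  obtain ⟨N, hN⟩ := parallelSwap.exists_dptm M fun A B w =>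
    (parallelSwap_yields M A B w).imp fun _ h => ⟨h.1, trivial⟩
  replace hF := fun x => hF _ _ _ _ (secondQuery_yields M D 0 x)
  -- The inputs whose second query is in `C`; `F` finds this word with at most one query to `D`.
  let A : Language Bool := {x | F.output D 0 x ∈ C}
  have hA : A ∈ 𝒞 := hdown A C hC ⟨F.output D 0, ⟨D, hD, F, fun x => (hF x).1, fun _ => rfl⟩,
    fun _ => Iff.rfl⟩
  replace hN := fun x => hN _ _ _ _ (parallelSwap_yields M A D x)
  refine ⟨A, hA, D, hD, N, fun x => by rw [(hN x).1]; simp, Set.ext fun x => ?_⟩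
  change M.accepting _ = true ↔ N.accepting _ = true
  rw [(hN x).2]
  have hx : answer A x = answer C (M.word (secondQueryCore M D x) .query₂) := by
    rw [Bool.eq_iff_iff, answer_eq_true, answer_eq_true, ← (hF x).2]
    rfl
  obtain ⟨hf, hc⟩ := DPTM.final_core_of_isOrdered hM x
  have s₀ := DPTM.first_settled (M := M) x
  have s₁ := DPTM.next_settled (M := M) D C x
  have hn (c : M.Core) (hs : M.Settled c) (he : M.event c.l = .halt) :
    M.next D C x c = c := DPTM.settle_reply_of_halt x hs he _ _
  have hq (he : M.event (M.first x).l = .fst) :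
      secondQueryCore M D x = M.next D C x (M.first x) := by
    rw [secondQueryCore, he, OracleTM.reply_of_event_eq_fst he _ _
      (answer C (M.word (M.first x) .query₂))]
    rfl
  have h₁ (he : M.event (M.first x).l = .fst) (b : Bool) :
      M.settle x (M.reply (answer D (M.word (M.first x) .query₁)) b (M.first x)) =
        M.next D C x (M.first x) := by
    rw [OracleTM.reply_of_event_eq_fst he _ _ (answer C (M.word (M.first x) .query₂))]
    rfl
  -- Replying twice is harmless if `M` makes fewer than two queries: a halted configuration ignores
  -- replies.
  suffices h : M.settle x (M.reply (answer D (M.word (M.first x) .query₁)) (answer A x)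
      (M.settle x (M.reply (answer D (M.word (M.first x) .query₁)) (answer A x) (M.first x)))) =
      (M.final D C x).core by rw [h]
  rw [hf]
  rcases hc with e | ⟨e, e'⟩ | ⟨e, e'⟩ | ⟨e, e'⟩
  · rw [DPTM.settle_reply_of_halt x s₀ e, DPTM.settle_reply_of_halt x s₀ e, hn _ s₀ e, hn _ s₀ e]
  · rw [h₁ e, DPTM.settle_reply_of_halt x s₁ e', hn _ s₁ e']
  · rw [h₁ e, hx, hq e, OracleTM.reply_of_event_eq_snd e' _
      (answer D (M.word (M.next D C x (M.first x)) .query₁))]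
    rfl
  · have h₀ : M.settle x (M.reply (answer D (M.word (M.first x) .query₁)) (answer A x)
        (M.first x)) = M.next D C x (M.first x) := by
      rw [hx, secondQueryCore, e]
      rfl
    rw [h₀, DPTM.settle_reply_of_halt x s₁ e', hn _ s₁ e']

theorem POrdered_subset_PParallel (hdown : ClosedDownwardOneQuery 𝒞 𝒟) :
    POrdered 𝒞 𝒟 ⊆ PParallel 𝒞 𝒟 := by
  rintro _ ⟨C, hC, D, hD, M, hM, rfl⟩
  have hpar (a : Bool) (acc : Bool → Bool → Bool) (A : Language Bool) : ∃ N : DPTM, ∀ x,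
      N.accesses A D x = [.both] ∧ N.accepting (N.final A D x).core.var =
        acc (answer A x) (guessVerdict M a D x) := by
    obtain ⟨N, hN⟩ := (parallelProbe a acc).exists_dptm M fun A B w =>
      (parallelProbe_yields M a acc A B w).imp fun _ h => ⟨h.1, trivial⟩
    exact ⟨N, fun x => hN _ _ _ _ (parallelProbe_yields M a acc A D x)⟩
  -- The second reduction needs a word outside `C`. If there is none, the guess `true` is always
  -- right.
  by_cases hu : ∀ y, y ∈ C
  · obtain ⟨N, hN⟩ := hpar true (fun _ r => r) C
    refine ⟨C, hC, D, hD, N, fun x => by rw [(hN x).1]; simp, Set.ext fun x => ?_⟩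
    change M.accepting _ = true ↔ N.accepting _ = true
    rw [(hN x).2, final_core_eq_guessNext (a := true) hM fun _ => (answer_eq_true.2 (hu _)).symm]
    rfl
  push Not at hu
  obtain ⟨y, hy⟩ := hu
  -- The marker `none` cuts off whatever lies below `y`; the empty list leaves the frozen query word
  -- as the output.
  let out₁ : Bool → Bool → List (Option Bool) :=
    fun b r => bif r == b then y.map some ++ [none] else []
  obtain ⟨F, hF⟩ := (probe true true (.stack .query₁) out₁).exists_dptm M fun A B w =>
    (probe_yields M _ _ _ _ A B w).imp fun _ h => ⟨h.1, trivial⟩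
  replace hF := fun x => hF _ _ _ _ (probe_yields M _ _ _ _ D 0 x)
  let out₀ : Bool → Bool → List (Option Bool) := fun _ r => [some r]
  obtain ⟨G, hG⟩ := (probe false false .word out₀).exists_dptm M fun A B w =>
    (probe_yields M _ _ _ _ A B w).imp fun _ h => ⟨h.1, trivial⟩
  replace hG := fun x => hG _ _ _ _ (probe_yields M _ _ _ _ D 0 x)
  -- Two successive reductions, since each may use only one query to `D`: `F` computes `v₁`, `G`
  -- computes `v₀`.
  let A₁ : Language Bool := {w | F.output D 0 w ∈ C}
  have hA₁ : A₁ ∈ 𝒞 := hdown A₁ C hC ⟨F.output D 0,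
    ⟨D, hD, F, fun x => by rw [(hF x).1], fun _ => rfl⟩, fun _ => Iff.rfl⟩
  let A : Language Bool := {x | G.output D 0 x ∈ A₁}
  have hA : A ∈ 𝒞 := hdown A A₁ hA₁ ⟨G.output D 0,
    ⟨D, hD, G, fun x => by rw [(hG x).1], fun _ => rfl⟩, fun _ => Iff.rfl⟩
  have hGo (x) : G.output D 0 x = guessVerdict M false D x :: x := by
    obtain ⟨rest, hr, hp⟩ := (hG x).2 x rfl
    rw [hr, hp (.inr rfl)]
    have := bitPrefix_map_inl (Γ := Option M.Γ) x []
    rw [List.append_nil] at this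
    exact congrArg (guessVerdict M false D x :: ·) (this.trans (List.append_nil x))
  have hF₁ (x b) (hb : guessVerdict M true D x = b) : F.output D 0 (b :: x) = y := by
    obtain ⟨rest, hr, -⟩ := (hF (b :: x)).2 x rfl
    have ho : out₁ b b = y.map some ++ [none] := by simp [out₁]
    have hy : ((y.map some ++ [none]).map (outSymbol (Γ := M.Γ))) ++ rest =
        y.map Sum.inl ++ (Sum.inr none :: rest) := by simp [outSymbol]
    rw [hr, hb]
    change bitPrefix ((out₁ b b).map outSymbol ++ rest) = y
    rw [ho, hy, bitPrefix_map_inl]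
    simp [bitPrefix]
  have hF₂ (x b) (hb : guessVerdict M true D x ≠ b) (he : M.event (M.first x).l = .fst) :
      F.output D 0 (b :: x) = M.word (M.first x) .query₁ := by
    obtain ⟨rest, hr, hp⟩ := (hF (b :: x)).2 x rfl
    have ho : out₁ b (guessVerdict M true D x) = [] := by
      simp only [out₁, beq_false_of_ne hb, cond_false]
    rw [hr, hp (.inl he)]
    change bitPrefix ((out₁ b (guessVerdict M true D x)).map outSymbol ++ _) = _
    rw [ho]
    exact bitPrefix_map_embed _
  obtain ⟨N, hN⟩ := hpar false xor A
  refine ⟨A, hA, D, hD, N, fun x => by rw [(hN x).1]; simp, Set.ext fun x => ?_⟩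
  change M.accepting _ = true ↔ N.accepting _ = true
  rw [(hN x).2, ← Bool.eq_iff_iff]
  have hAx : answer A x = answer C (F.output D 0 (guessVerdict M false D x :: x)) := by
    rw [← hGo, Bool.eq_iff_iff, answer_eq_true, answer_eq_true]
    rfl
  have hCy : answer C y = false := by
    rw [← Bool.not_eq_true, answer_eq_true]
    exact hy
  have hv (a : Bool) (ha : M.event (M.first x).l = .fst →
      a = answer C (M.word (M.first x) .query₁)) :
      M.accepting (M.final C D x).core.var = guessVerdict M a D x := by
    rw [final_core_eq_guessNext hM ha]
    rfl
  -- Equal verdicts send `x` to `y ∉ C`, so the xor leaves `v₀`. Different verdicts force a first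
  -- query, and its answer in `C` tells whether `v₀` must be flipped.
  by_cases hg : guessVerdict M true D x = guessVerdict M false D x
  · rw [hAx, hF₁ x _ hg, hCy, Bool.false_xor]
    cases ha : answer C (M.word (M.first x) .query₁)
    · exact hv false fun _ => ha.symm
    · rw [← hg]
      exact hv true fun _ => ha.symm
  · have he : M.event (M.first x).l = .fst := by
      by_contra he
      exact hg ((hv true fun h => absurd h he).symm.trans (hv false fun h => absurd h he))
    rw [hAx, hF₂ x _ hg he, hv _ fun _ => rfl]
    cases answer C (M.word (M.first x) .query₁)
    · rw [Bool.false_xor]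
    · cases h₁ : guessVerdict M true D x <;> cases h₀ : guessVerdict M false D x <;> simp_all

end QueryOrder

theorem theoremt (𝒞 𝒟 : QueryOrder.ComplexityClass)
    (hunion : QueryOrder.ClosedUnderDisjointUnion 𝒞)
    (hdown : QueryOrder.ClosedDownwardOneQuery 𝒞 𝒟) :
    QueryOrder.POrdered 𝒞 𝒟 = QueryOrder.POrdered 𝒟 𝒞 ∧
      QueryOrder.POrdered 𝒟 𝒞 = QueryOrder.PParallel 𝒞 𝒟 := by
  have h₁ : QueryOrder.POrdered 𝒞 𝒟 = QueryOrder.PParallel 𝒞 𝒟 :=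
    (QueryOrder.POrdered_subset_PParallel hdown).antisymm
      (QueryOrder.PParallel_subset_POrdered 𝒞 𝒟)
  have h₂ : QueryOrder.POrdered 𝒟 𝒞 = QueryOrder.PParallel 𝒞 𝒟 :=
    (QueryOrder.POrdered_swap_subset_PParallel hdown).antisymm
      (QueryOrder.PParallel_subset_POrdered_swap 𝒞 𝒟)
  exact ⟨h₁.trans h₂.symm, h₂⟩
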